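/- All digraphs are finite, without loops, and with at most one arc between any two vertices; write $u\to v$ if $uv$ is an arc, $N^+(v)=\{u: v\to u\}$ and $N^-(v)=\{u: u\to v\}$. A *tournament* is a digraph with exactly one arc between any two distinct vertices, and a digraph is *Eulerian* if $|N^+(v)|=|N^-(v)|$ for every vertex $v$. Let $D$ be a digraph with vertex set $V$. A *restriction vector* is a function $r:V\to\mathbb{Z}_{\ge 0}$, with support $\mathrm{supp}(r)=\{v: r_v>0\}$; $\delta_v$ denotes the indicator vector of $v$. A *strategy* $\mathcal N$ for Norman assigns to every restriction vector $r$ a random vertex $\mathcal N(r)\in V$. A *strategy* $\mathcal R$ for Rei assigns to every restriction vector $r\neq 0$ a random vertex $\mathcal R(r)\in\mathrm{supp}(r)$. In the *semi-restricted $D$-game with parameter $r$*, as long as the current restriction vector $r$ is non-zero, a round is played: the players simultaneously (independently of each other and, given $r$, of the past) choose $a=\mathcal N(r)$ and $b=\mathcal R(r)$; Norman's score changes by $+1$ if $a\to b$, by $-1$ if $b\to a$, and by $0$ otherwise; then $r$ is replaced by $r-\delta_b$. Let $S_D(r;\mathcal N,\mathcal R)$ be the expectation of Norman's total score, and put $S_D(r;\mathcal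 R)=\max_{\mathcal N}S_D(r;\mathcal N,\mathcal R)$ and $S_D(r)=\min_{\mathcal R}S_D(r;\mathcal R)$. A strategy $\mathcal R$ for Rei is *optimal* if $S_D(r;\mathcal R)=S_D(r)$ for all restriction vectors $r$, and it is *oblivious* if the distribution of $\mathcal R(r)$ depends only on $\mathrm{supp}(r)$. The digraph $D$ is *oblivious* if Rei has at least one optimal strategy which is oblivious. **Theorem.** For $n\ge 1$ let $\mathcal E_n$ be the (non-empty) set of Eulerian tournaments with vertex set $\{1,\dots,2n+1\}$. There is an absolute constant $C>0$ such that for all $n\ge 1$, if $D$ is chosen uniformly at random from $\mathcal E_n$, then $$\Pr(D\text{ is oblivious})\le C\,n^{-2}.$$ -/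

import Mathlib

namespace SemiRestricted

noncomputable section

/-! ### Digraphs and tournaments -/

section Digraphs

variable {V : Type*}

/-- The out-neighbourhood `N⁺(v) = {u | v → u}`. -/
def outNbhd (D : Digraph V) (v : V) : Set V := {u | D.Adj v u}

/-- The in-neighbourhood `N⁻(v) = {u | u → v}`. -/
def inNbhd (D : Digraph V) (v : V) : Set V := {u | D.Adj u v}

/-- A tournament: no loops, and exactly one arc between any two distinct vertices. -/
def IsTournament (D : Digraph V) : Prop :=
  (∀ v, ¬ D.Adj v v) ∧ ∀ u v, u ≠ v → (D.Adj u v ↔ ¬ D.Adj v u)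

/-- A digraph on a finite vertex set is Eulerian if `d⁺(v) = d⁻(v)` for every vertex `v`. -/
def IsEulerian [Finite V] (D : Digraph V) : Prop :=
  ∀ v, (outNbhd D v).ncard = (inNbhd D v).ncard

open Classical in
/-- The number of points gained by a player choosing `a` against an opponent choosing `b` in one
round of the `D`-game. -/
def payoff (D : Digraph V) (a b : V) : ℤ :=
  if b ∈ outNbhd D a then 1 else if b ∈ inNbhd D a then -1 else 0

end Digraphs

/-! ### The semi-restricted game

A restriction vector is a function `r : V → ℕ`; `r v` is the number of times that Rei still has
to play `v`. -/

section Game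

variable {V : Type*}

/-- A strategy for Norman: to every restriction vector it assigns (the law of) a random vertex. -/
abbrev NormanStrategy (V : Type*) : Type _ := (V → ℕ) → PMF V

/-- A strategy for Rei: to every restriction vector it assigns (the law of) a random vertex which
lies in the support of the restriction vector. At `r = 0` the game is over and nothing is played,
so the value there is irrelevant. -/
structure ReiStrategy (V : Type*) where
  /-- The law of Rei's next move. -/
  play : (V → ℕ) → PMF V
  support_subset : ∀ r : V → ℕ, r ≠ 0 → (play r).support ⊆ Function.support r

variable [Fintype V] [DecidableEq V]

/-- Playing an available option lowers the number of remaining rounds. -/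
theorem sum_sub_single_lt (r : V → ℕ) (b : V) (hb : b ∈ Function.support r) :
    ∑ v, (r - Pi.single b 1 : V → ℕ) v < ∑ v, r v := by
  have hb' : r b ≠ 0 := hb
  refine Finset.sum_lt_sum (fun v _ => Nat.sub_le _ _) ⟨b, Finset.mem_univ b, ?_⟩
  simp only [Pi.sub_apply, Pi.single_eq_same]
  omega

/-- The law of Norman's (random) score in the semi-restricted `D`-game with parameter `r`, when
Norman plays `N` and Rei plays `R`. In each round the moves are drawn simultaneously, i.e.
independently of each other and of the past given the current restriction vector. -/
def score (D : Digraph V) (N : NormanStrategy V) (R : ReiStrategy V) (r : V → ℕ) : PMF ℤ :=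
  open Classical in
  if h : r = 0 then PMF.pure 0
  else (N r).bind fun a =>
    (R.play r).bindOnSupport fun b _ =>
      (score D N R (r - Pi.single b 1)).map fun s => payoff D a b + s
termination_by ∑ v, r v
decreasing_by exact sum_sub_single_lt r b (R.support_subset r h ‹_›)

/-- Norman's expected score. -/
def expectedScore (D : Digraph V) (r : V → ℕ) (N : NormanStrategy V) (R : ReiStrategy V) : ℝ :=
  ∫ s : ℤ, (s : ℝ) ∂(score D N R r).toMeasure

/-- Norman's expected score against `R` if he plays optimally. -/
def valueAgainst (D : Digraph V) (r : V → ℕ) (R : ReiStrategy V) : ℝ :=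
  ⨆ N : NormanStrategy V, expectedScore D r N R

/-- Norman's expected score if both players play optimally. -/
def value (D : Digraph V) (r : V → ℕ) : ℝ :=
  ⨅ R : ReiStrategy V, valueAgainst D r R

/-- A strategy for Rei is optimal if it is optimal for every restriction vector. -/
def ReiStrategy.IsOptimal (D : Digraph V) (R : ReiStrategy V) : Prop :=
  ∀ r : V → ℕ, value D r = valueAgainst D r R

/-- A strategy for Rei is oblivious if the law of her move depends only on the support of the
restriction vector. -/
def ReiStrategy.IsOblivious (R : ReiStrategy V) : Prop :=
  ∀ r r' : V → ℕ, Function.support r = Function.support r' → R.play r = R.play r'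

/-- A digraph is oblivious if Rei has at least one oblivious optimal strategy. -/
def IsObliviousDigraph (D : Digraph V) : Prop :=
  ∃ R : ReiStrategy V, R.IsOptimal D ∧ R.IsOblivious

/-! The suprema and infima above are those of bounded families. -/

theorem score_zero (D : Digraph V) (N : NormanStrategy V) (R : ReiStrategy V) :
    score D N R 0 = PMF.pure 0 := by
  rw [score]; simp

theorem score_of_ne_zero (D : Digraph V) (N : NormanStrategy V) (R : ReiStrategy V)
    (r : V → ℕ) (h : r ≠ 0) :
    score D N R r = (N r).bind fun a => (R.play r).bind fun b =>
      (score D N R (r - Pi.single b 1)).map fun s => payoff D a b + s := by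
  rw [score]
  simp [h, PMF.bindOnSupport_eq_bind]

theorem abs_le_of_mem_support_score (D : Digraph V) (N : NormanStrategy V) (R : ReiStrategy V)
    (r : V → ℕ) : ∀ s ∈ (score D N R r).support, |s| ≤ ((∑ v, r v : ℕ) : ℤ) := by
  induction hk : ∑ v, r v using Nat.strong_induction_on generalizing r with
  | _ k ih =>
    intro s hs
    by_cases h : r = 0
    · subst h
      rw [score_zero] at hs
      simp at hs
      simp [hs]
    · rw [score_of_ne_zero D N R r h] at hs
      simp only [PMF.mem_support_bind_iff, PMF.mem_support_map_iff] at hs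
      obtain ⟨a, -, b, hb, t, ht, rfl⟩ := hs
      have hlt := sum_sub_single_lt r b (R.support_subset r h hb)
      have h1 := ih _ (hk ▸ hlt) (r - Pi.single b 1) rfl t ht
      have h2 : |payoff D a b| ≤ 1 := by
        unfold payoff; split_ifs <;> simp
      have h3 := abs_add_le (payoff D a b) t
      omega

theorem abs_expectedScore_le (D : Digraph V) (r : V → ℕ) (N : NormanStrategy V)
    (R : ReiStrategy V) : |expectedScore D r N R| ≤ ((∑ v, r v : ℕ) : ℝ) := by
  have hae : ∀ᵐ s : ℤ ∂(score D N R r).toMeasure, ‖(s : ℝ)‖ ≤ ((∑ v, r v : ℕ) : ℝ) := by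
    rw [MeasureTheory.ae_iff, PMF.toMeasure_apply_eq_zero_iff _ (MeasurableSet.of_discrete)]
    rw [Set.disjoint_left]
    intro s hs hs'
    apply hs'
    have := abs_le_of_mem_support_score D N R r s hs
    rw [Real.norm_eq_abs]
    exact_mod_cast this
  have := MeasureTheory.norm_integral_le_of_norm_le_const hae
  simpa [expectedScore] using this

end Game

/-! ### Random Eulerian tournaments -/

open Classical in
/-- The set of Eulerian tournaments on `2n + 1` labelled vertices. -/
def eulerianTournaments (n : ℕ) : Finset (Digraph (Fin (2 * n + 1))) :=
  Finset.univ.filter fun D => IsTournament D ∧ IsEulerian D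

theorem eulerianTournaments_nonempty (n : ℕ) : (eulerianTournaments n).Nonempty := by
  have key : ∀ u v : Fin (2 * n + 1), u ≠ v →
      (((v - u).val ≤ n) ↔ ¬ ((u - v).val ≤ n)) := by
    intro u v huv
    have := u.isLt
    have := v.isLt
    rcases lt_or_gt_of_ne huv with h | h
    · rw [Fin.coe_sub_iff_le.2 h.le, Fin.coe_sub_iff_lt.2 h]
      have : u.val < v.val := h
      omega
    · rw [Fin.coe_sub_iff_le.2 h.le, Fin.coe_sub_iff_lt.2 h]
      have : v.val < u.val := h
      omega
  refine ⟨⟨fun u v => u ≠ v ∧ (v - u).val ≤ n⟩, ?_⟩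
  simp only [eulerianTournaments, Finset.mem_filter, Finset.mem_univ, true_and]
  refine ⟨⟨fun v h => h.1 rfl, fun u v huv => ?_⟩, fun v => ?_⟩
  · have := key u v huv
    have h' := huv.symm
    simp only [ne_eq, huv, h', not_false_eq_true, true_and]
    exact this
  · refine Set.ncard_congr (fun u _ => v + v - u) ?_ ?_ ?_
    · rintro u ⟨h1, h2⟩
      refine ⟨fun h => h1 ?_, ?_⟩
      · have : v - u = 0 := by rw [← sub_eq_zero.2 h]; abel
        exact sub_eq_zero.1 this
      · have : v - (v + v - u) = u - v := by abel
        rw [this]; exact h2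
    · intro a b _ _ h
      exact sub_right_injective h
    · rintro u ⟨h1, h2⟩
      refine ⟨v + v - u, ⟨fun h => h1 ?_, ?_⟩, by abel⟩
      · have : v - u = 0 := by
          have : v + v - u - v = 0 := by rw [← h]; simp
          rw [← this]; abel
        exact (sub_eq_zero.1 this).symm
      · have : v + v - u - v = v - u := by abel
        rw [this]; exact h2

/-- A uniformly random Eulerian tournament on `2n + 1` labelled vertices. -/
def randomEulerianTournament (n : ℕ) : PMF (Digraph (Fin (2 * n + 1))) :=
  PMF.uniformOfFinset (eulerianTournaments n) (eulerianTournaments_nonempty n)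

end

end SemiRestricted

/-! Consider `M • r` for large `M`. If Rei plays her remaining moves in uniformly random order,
Norman gets at most `M` times his best total payoff against `r`, up to an error `o(M)`
(`valueAgainst_proportionalStrategy_le`). Suppose now that Rei is oblivious and plays by the law `p`
while the support is that of `r`. Let `w` maximize the total payoff against `r`. If some `a` beat
`p` by `γ > 0` more than `w` does, Norman would play `a` during the at least `M` rounds in which the
support is unchanged, then `w`, and gain an extra `γ M`. Hence `w` must also be a best reply to `p`
(`isMax_of_oblivious`).

In an Eulerian tournament fix `v` and suppose that no `N⁺(w)` is contained in `N⁺(a) ∪ {v}` with `a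
≠ w`. Then for every `w` there is an `r` with support `V \ {v}` whose best reply is `w`. All moves
are thus best replies to the same `p`, so `p` lies in the kernel of the payoff matrix while `p v =
0`; a determinant modulo 2 forces `p = 0`, which is absurd (`exists_outNbhd_diff_subset`).

Therefore an oblivious `D` has a pair `a ≠ w` with `|N⁺(w) \ N⁺(a)| ≤ 1`. For a fixed pair this has
probability `O(n⁻⁴)`: reversing cyclic triangles through `a` shows that raising the bound on the
difference by one multiplies the count by order `n²` (`sq_mul_card_almostNested_le`), and this is
done twice. A union bound over `O(n²)` pairs concludes. -/

namespace SemiRestricted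

/-! ### Means of boundedly supported integer laws as finite sums -/

section Expectation

/-- The expectation of an integer-valued random variable with law `p`. -/
noncomputable def mean (p : PMF ℤ) : ℝ := ∫ s : ℤ, (s : ℝ) ∂p.toMeasure

theorem integrable_of_bounded_support {p : PMF ℤ} {K : ℕ} (h : ∀ s ∈ p.support, |s| ≤ (K : ℤ)) :
    MeasureTheory.Integrable (fun s : ℤ => (s : ℝ)) p.toMeasure := by
  refine MeasureTheory.Integrable.of_bound
    (Measurable.of_discrete).aestronglyMeasurable (K : ℝ) ?_
  rw [MeasureTheory.ae_iff, PMF.toMeasure_apply_eq_zero_iff _ (MeasurableSet.of_discrete),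
    Set.disjoint_left]
  intro s hs hs'
  apply hs'
  rw [Real.norm_eq_abs]
  exact_mod_cast h s hs

theorem mean_eq_sum {p : PMF ℤ} {K : ℕ} (h : ∀ s ∈ p.support, |s| ≤ (K : ℤ)) :
    mean p = ∑ s ∈ Finset.Icc (-(K : ℤ)) K, (p s).toReal * s := by
  rw [mean, PMF.integral_eq_tsum _ _ (integrable_of_bounded_support h),
    tsum_eq_sum (s := Finset.Icc (-(K : ℤ)) K)]
  · simp
  · intro s hs
    have : p s = 0 := by
      by_contra h0
      exact hs (Finset.mem_Icc.2 (abs_le.1 (h s ((PMF.mem_support_iff _ _).2 h0))))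
    simp [this]

theorem mean_bind {V : Type*} [Fintype V] (p : PMF V) (f : V → PMF ℤ) {K : ℕ}
    (h : ∀ a, ∀ s ∈ (f a).support, |s| ≤ (K : ℤ)) :
    mean (p.bind f) = ∑ a, (p a).toReal * mean (f a) := by
  have h' : ∀ s ∈ (p.bind f).support, |s| ≤ (K : ℤ) := by
    intro s hs
    obtain ⟨a, -, ha⟩ := (PMF.mem_support_bind_iff _ _ _).1 hs
    exact h a s ha
  rw [mean_eq_sum h']
  simp_rw [mean_eq_sum (h _), Finset.mul_sum]
  rw [Finset.sum_comm]
  refine Finset.sum_congr rfl fun s _ => ?_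
  rw [PMF.bind_apply, tsum_fintype, ENNReal.toReal_sum, Finset.sum_mul]
  · simp [mul_assoc]
  · intro a _
    exact ENNReal.mul_ne_top (PMF.apply_ne_top _ _) (PMF.apply_ne_top _ _)

theorem mean_map_add (p : PMF ℤ) (c : ℤ) {K : ℕ} (h : ∀ s ∈ p.support, |s| ≤ (K : ℤ)) :
    mean (p.map fun s => c + s) = c + mean p := by
  have hi := integrable_of_bounded_support h
  rw [mean, ← PMF.toMeasure_map (p := p) _ (Measurable.of_discrete),
    MeasureTheory.integral_map (Measurable.of_discrete).aemeasurable
      (Measurable.of_discrete).aestronglyMeasurable]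
  simp only [Int.cast_add]
  rw [MeasureTheory.integral_add (MeasureTheory.integrable_const _) hi]
  simp [mean]

theorem sum_toReal {V : Type*} [Fintype V] (p : PMF V) : ∑ a, (p a).toReal = 1 := by
  rw [← ENNReal.toReal_sum fun a _ => PMF.apply_ne_top p a, ← tsum_fintype (L := .unconditional _),
    PMF.tsum_coe, ENNReal.toReal_one]

end Expectation

/-! ### One-round recursion for the expected score -/

section Recursion

variable {V : Type*} [Fintype V] [DecidableEq V]

theorem sum_sub_single_le (r : V → ℕ) (b : V) :
    ∑ v, (r - Pi.single b 1 : V → ℕ) v ≤ ∑ v, r v :=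
  Finset.sum_le_sum fun _ _ => Nat.sub_le _ _

theorem expectedScore_zero (D : Digraph V) (N : NormanStrategy V) (R : ReiStrategy V) :
    expectedScore D 0 N R = 0 := by
  have h : ∀ s ∈ (PMF.pure (0 : ℤ)).support, |s| ≤ ((0 : ℕ) : ℤ) := by simp
  rw [expectedScore, score_zero]
  refine (mean_eq_sum h).trans ?_
  simp

/-- The later inductions on the number of remaining rounds use the score in this finite form. -/
theorem expectedScore_of_ne_zero (D : Digraph V) (N : NormanStrategy V) (R : ReiStrategy V)
    {r : V → ℕ} (hr : r ≠ 0) :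
    expectedScore D r N R = ∑ a, (N r a).toReal * ∑ b, (R.play r b).toReal *
      ((payoff D a b : ℝ) + expectedScore D (r - Pi.single b 1) N R) := by
  have hb : ∀ b, ∀ s ∈ (score D N R (r - Pi.single b 1)).support, |s| ≤ ((∑ v, r v : ℕ) : ℤ) := by
    intro b s hs
    exact (abs_le_of_mem_support_score D N R _ s hs).trans
      (by exact_mod_cast sum_sub_single_le r b)
  have hm : ∀ a b, ∀ s ∈ ((score D N R (r - Pi.single b 1)).map
      fun s => payoff D a b + s).support, |s| ≤ ((∑ v, r v + 1 : ℕ) : ℤ) := by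
    intro a b s hs
    obtain ⟨t, ht, rfl⟩ := (PMF.mem_support_map_iff _ _ _).1 hs
    have h1 := hb b t ht
    have h2 : |payoff D a b| ≤ 1 := by unfold payoff; split_ifs <;> simp
    have h3 := abs_add_le (payoff D a b) t
    push_cast at h1 ⊢
    linarith
  rw [expectedScore, score_of_ne_zero D N R r hr]
  refine (mean_bind (K := ∑ v, r v + 1) _ _ fun a s hs => ?_).trans ?_
  · obtain ⟨b, -, h⟩ := (PMF.mem_support_bind_iff _ _ _).1 hs
    exact hm a b s h
  · refine Finset.sum_congr rfl fun a _ => ?_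
    rw [mean_bind _ _ (hm a)]
    congr 1
    refine Finset.sum_congr rfl fun b _ => ?_
    rw [mean_map_add _ _ (hb b)]
    rfl

end Recursion

/-! ### Elementary bounds for the game values -/

section Value

variable {V : Type*} [Fintype V] [DecidableEq V]

theorem expectedScore_le_valueAgainst (D : Digraph V) (r : V → ℕ) (N : NormanStrategy V)
    (R : ReiStrategy V) : expectedScore D r N R ≤ valueAgainst D r R := by
  refine le_ciSup (f := fun N => expectedScore D r N R) ⟨((∑ v, r v : ℕ) : ℝ), ?_⟩ N
  rintro _ ⟨N, rfl⟩
  exact (abs_le.1 (abs_expectedScore_le D r N R)).2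

theorem value_le_valueAgainst [Nonempty V] (D : Digraph V) (r : V → ℕ) (R : ReiStrategy V) :
    value D r ≤ valueAgainst D r R := by
  refine ciInf_le ⟨-((∑ v, r v : ℕ) : ℝ), ?_⟩ R
  rintro _ ⟨R, rfl⟩
  let N : NormanStrategy V := fun _ => PMF.pure (Classical.arbitrary V)
  exact (abs_le.1 (abs_expectedScore_le D r N R)).1.trans (expectedScore_le_valueAgainst D r N R)

theorem valueAgainst_le [Nonempty V] {D : Digraph V} {r : V → ℕ} {R : ReiStrategy V} {c : ℝ}
    (h : ∀ N, expectedScore D r N R ≤ c) : valueAgainst D r R ≤ c := by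
  have : Nonempty (NormanStrategy V) := ⟨fun _ => PMF.pure (Classical.arbitrary V)⟩
  exact ciSup_le h

end Value

/-! ### Upper bound: Rei plays in uniformly random order -/

section Proportional

/-- The payoff matrix of the `D`-game, with real entries. -/
noncomputable def payoffMatrix {V : Type*} (D : Digraph V) : Matrix V V ℝ :=
  fun a b => (payoff D a b : ℝ)

theorem abs_payoffMatrix_le {V : Type*} (D : Digraph V) (a b : V) : |payoffMatrix D a b| ≤ 1 := by
  unfold payoffMatrix payoff
  split_ifs <;> simp

variable {V : Type*} [Fintype V] [DecidableEq V]

/-- The law which gives `v` a probability proportional to `r v`. -/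
noncomputable def proportionalLaw (r : V → ℕ) (hr : r ≠ 0) : PMF V :=
  PMF.normalize (fun v => (r v : ENNReal))
    (by
      rw [tsum_fintype]
      intro h
      apply hr
      funext v
      have := (Finset.sum_eq_zero_iff.1 h) v (Finset.mem_univ v)
      exact_mod_cast this)
    (by
      rw [tsum_fintype]
      exact ENNReal.sum_ne_top.2 fun v _ => ENNReal.natCast_ne_top _)

theorem proportionalLaw_toReal {W : Type*} [Fintype W] (r : W → ℕ) (hr : r ≠ 0) (v : W) :
    (proportionalLaw r hr v).toReal = (r v : ℝ) / ∑ u, (r u : ℝ) := by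
  rw [proportionalLaw, PMF.normalize_apply, tsum_fintype, ← div_eq_mul_inv, ENNReal.toReal_div,
    ENNReal.toReal_sum fun v _ => ENNReal.natCast_ne_top _]
  simp

/-- Rei plays the remaining moves in uniformly random order. -/
noncomputable def proportionalStrategy [Nonempty V] : ReiStrategy V where
  play r := if hr : r = 0 then PMF.pure (Classical.arbitrary V) else proportionalLaw r hr
  support_subset r hr v hv := by
    rw [dif_neg hr, PMF.mem_support_iff] at hv
    intro h0
    apply hv
    rw [proportionalLaw, PMF.normalize_apply, h0]
    simp

theorem proportionalStrategy_toReal {W : Type*} [Fintype W] [Nonempty W] {r : W → ℕ} (hr : r ≠ 0)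
    (v : W) :
    ((proportionalStrategy.play r) v).toReal = (r v : ℝ) / ∑ u, (r u : ℝ) := by
  have : proportionalStrategy.play r = proportionalLaw r hr := dif_neg hr
  rw [this, proportionalLaw_toReal]

/-- The total of the payoffs of a fixed move `a` against all moves listed in `r`. -/
noncomputable def totalPayoff (D : Digraph V) (r : V → ℕ) (a : V) : ℝ :=
  ∑ b, payoffMatrix D a b * r b

theorem cast_sub_single {W : Type*} [DecidableEq W] {r : W → ℕ} {b : W} (hb : r b ≠ 0) (v : W) :
    (((r - Pi.single b 1 : W → ℕ) v : ℕ) : ℝ) = r v - if v = b then 1 else 0 := by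
  by_cases h : v = b
  · subst h
    have : 1 ≤ r v := Nat.one_le_iff_ne_zero.2 hb
    simp [Nat.cast_sub this]
  · simp [h]

theorem totalPayoff_sub_single (D : Digraph V) {r : V → ℕ} {b : V} (hb : r b ≠ 0) (a : V) :
    totalPayoff D (r - Pi.single b 1) a = totalPayoff D r a - payoffMatrix D a b := by
  simp only [totalPayoff, cast_sub_single hb, mul_sub, Finset.sum_sub_distrib]
  simp

theorem sum_cast_sub_single {r : V → ℕ} {b : V} (hb : r b ≠ 0) :
    ∑ v, (((r - Pi.single b 1 : V → ℕ) v : ℕ) : ℝ) = ∑ v, (r v : ℝ) - 1 := by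
  simp only [cast_sub_single hb, Finset.sum_sub_distrib]
  simp

theorem sum_sub_single {r : V → ℕ} {b : V} (hb : r b ≠ 0) :
    ∑ v, (r - Pi.single b 1 : V → ℕ) v + 1 = ∑ v, r v := by
  have h := sum_cast_sub_single hb
  have : ((∑ v, (r - Pi.single b 1 : V → ℕ) v + 1 : ℕ) : ℝ) = (∑ v, r v : ℕ) := by
    push_cast
    linarith
  exact_mod_cast this

/-- A mixed move of Norman is a convex combination of pure ones. -/
theorem expectedScore_le_of_forall_move (D : Digraph V) (N : NormanStrategy V) (R : ReiStrategy V)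
    {r : V → ℕ} (hr : r ≠ 0) {c : ℝ}
    (h : ∀ a, ∑ b, (R.play r b).toReal *
      (payoffMatrix D a b + expectedScore D (r - Pi.single b 1) N R) ≤ c) :
    expectedScore D r N R ≤ c := by
  rw [expectedScore_of_ne_zero D N R hr]
  calc _ ≤ ∑ a, (N r a).toReal * c :=
        Finset.sum_le_sum fun a _ => mul_le_mul_of_nonneg_left (h a) ENNReal.toReal_nonneg
    _ = c := by rw [← Finset.sum_mul, sum_toReal, one_mul]

/-- The potential bounding Norman's score against the proportional strategy: `μ` bounds the average
payoffs `z`, the quadratic term measures the deviation of the remaining moves from these averages,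
and the last two terms account for the future fluctuations. -/
noncomputable def potential (D : Digraph V) (z : V → ℝ) (μ α : ℝ) (r : V → ℕ) : ℝ :=
  (∑ v, (r v : ℝ)) * μ + α * ∑ a, (totalPayoff D r a - (∑ v, (r v : ℝ)) * z a) ^ 2
    + (4 * Fintype.card V * α * (∑ v, (r v : ℝ))
      + (8 * α)⁻¹ * ∑ i ∈ Finset.range (∑ v, r v), ((i : ℝ) + 1)⁻¹)

/-- The current payoff exceeds its average `z a` by `d a / t`. The quadratic term shrinks in mean by
the factor `1 - 2 / t`, since the deviations `d` are pulled towards zero, and this loss pays for the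
excess by the inequality of arithmetic and geometric means. -/
theorem potential_step (D : Digraph V) {z : V → ℝ} {μ α : ℝ} (hz : ∀ a, |z a| ≤ 1)
    (hμ : ∀ a, z a ≤ μ) (hα : 0 < α) {r : V → ℕ} (hr : r ≠ 0) (a : V) :
    ∑ b, ((r b : ℝ) / ∑ u, (r u : ℝ)) *
      (payoffMatrix D a b + potential D z μ α (r - Pi.single b 1)) ≤ potential D z μ α r := by
  set t : ℝ := ∑ u, (r u : ℝ) with ht
  obtain ⟨m, hm⟩ : ∃ m, ∑ u, r u = m + 1 := by
    refine Nat.exists_eq_succ_of_ne_zero fun h => hr ?_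
    funext v
    exact (Finset.sum_eq_zero_iff.1 h) v (Finset.mem_univ v)
  have htm : t = m + 1 := by rw [ht]; exact_mod_cast hm
  have htpos : 0 < t := by rw [htm]; positivity
  set y := totalPayoff D r with hy
  set H : ℝ := ∑ i ∈ Finset.range m, ((i : ℝ) + 1)⁻¹ with hH
  set d : V → ℝ := fun a => y a - t * z a with hd
  set Q : V → ℝ := fun b => ∑ c, (d c - (payoffMatrix D c b - z c)) ^ 2 with hQ
  -- If `r b = 0`, truncated subtraction leaves `r` unchanged, but such `b` have weight zero in the
  -- sum.
  have hpot : ∀ b, r b ≠ 0 → potential D z μ α (r - Pi.single b 1) =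
      (t - 1) * μ + α * Q b + (4 * Fintype.card V * α * (t - 1) + (8 * α)⁻¹ * H) := by
    intro b hb
    have hs : ∑ v, (r - Pi.single b 1 : V → ℕ) v = m := by
      have := sum_sub_single hb
      omega
    simp only [potential, sum_cast_sub_single hb, totalPayoff_sub_single D hb, hs, hQ, hd]
    congr 3
    refine Finset.sum_congr rfl fun c _ => ?_
    ring
  have hpotr : potential D z μ α r = t * μ + α * ∑ c, d c ^ 2 +
      (4 * Fintype.card V * α * t + (8 * α)⁻¹ * (H + t⁻¹)) := by
    simp only [potential, hm, Finset.sum_range_succ, ← htm, hH, hd, hy, ← ht]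
  have hw : ∑ b, (r b : ℝ) / t = 1 := by
    rw [← Finset.sum_div, ← ht, div_self htpos.ne']
  have hmean : ∀ c, ∑ b, (r b : ℝ) / t * payoffMatrix D c b = y c / t := by
    intro c
    rw [hy, totalPayoff, Finset.sum_div]
    exact Finset.sum_congr rfl fun b _ => by ring
  -- In the expanded square, the mean of `payoffMatrix D c b - z c` is `d c / t`, and its square is
  -- at most `4`.
  have hQmean : ∑ b, (r b : ℝ) / t * Q b ≤
      (1 - 2 / t) * ∑ c, d c ^ 2 + 4 * Fintype.card V := by
    have h1 : ∀ b, Q b ≤ ∑ c, (d c ^ 2 - 2 * d c * (payoffMatrix D c b - z c) + 4) := by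
      intro b
      refine Finset.sum_le_sum fun c _ => ?_
      have h2 := abs_le.1 (abs_payoffMatrix_le D c b)
      have h3 := abs_le.1 (hz c)
      have h4 : (payoffMatrix D c b - z c) ^ 2 ≤ 4 := by
        nlinarith [h2.1, h2.2, h3.1, h3.2]
      nlinarith [h4]
    calc _ ≤ ∑ b, (r b : ℝ) / t *
            ∑ c, (d c ^ 2 - 2 * d c * (payoffMatrix D c b - z c) + 4) :=
          Finset.sum_le_sum fun b _ => mul_le_mul_of_nonneg_left (h1 b) (by positivity)
      _ = ∑ c, ∑ b, (r b : ℝ) / t * (d c ^ 2 - 2 * d c * (payoffMatrix D c b - z c) + 4) := by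
          simp_rw [Finset.mul_sum]
          exact Finset.sum_comm
      _ = ∑ c, ((1 - 2 / t) * d c ^ 2 + 4) := by
          refine Finset.sum_congr rfl fun c _ => ?_
          have : ∀ b, (r b : ℝ) / t * (d c ^ 2 - 2 * d c * (payoffMatrix D c b - z c) + 4) =
              (d c ^ 2 + 2 * d c * z c + 4) * ((r b : ℝ) / t)
                - 2 * d c * ((r b : ℝ) / t * payoffMatrix D c b) := fun b => by ring
          simp_rw [this]
          rw [Finset.sum_sub_distrib, ← Finset.mul_sum, ← Finset.mul_sum, hw, hmean]
          simp only [hd]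
          field_simp
          ring
      _ = _ := by
          rw [Finset.sum_add_distrib, ← Finset.mul_sum]
          simp
          ring
  have hrow : y a / t ≤ μ + 2 * α / t * ∑ c, d c ^ 2 + (8 * α)⁻¹ * t⁻¹ := by
    have h1 : y a / t = z a + d a / t := by
      simp only [hd]
      field_simp
      ring
    have h2 : d a ≤ 2 * α * d a ^ 2 + (8 * α)⁻¹ := by
      have : 2 * α * d a ^ 2 + (8 * α)⁻¹ - d a = 2 * α * (d a - (4 * α)⁻¹) ^ 2 := by
        field_simp
        ring
      nlinarith [mul_nonneg hα.le (sq_nonneg (d a - (4 * α)⁻¹))]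
    have h3 : d a ^ 2 ≤ ∑ c, d c ^ 2 :=
      Finset.single_le_sum (f := fun c => d c ^ 2) (fun c _ => sq_nonneg _) (Finset.mem_univ a)
    have h4 : d a ≤ 2 * α * ∑ c, d c ^ 2 + (8 * α)⁻¹ := by
      nlinarith [mul_le_mul_of_nonneg_left h3 hα.le]
    have h5 := div_le_div_of_nonneg_right h4 htpos.le
    rw [h1]
    calc z a + d a / t ≤ μ + (2 * α * ∑ c, d c ^ 2 + (8 * α)⁻¹) / t := add_le_add (hμ a) h5
      _ = _ := by rw [add_div]; ring
  calc _ = ∑ b, ((r b : ℝ) / t * payoffMatrix D a b + α * ((r b : ℝ) / t * Q b)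
        + ((t - 1) * μ + (4 * Fintype.card V * α * (t - 1) + (8 * α)⁻¹ * H))
          * ((r b : ℝ) / t)) := by
        refine Finset.sum_congr rfl fun b _ => ?_
        by_cases hb : r b = 0
        · simp [hb]
        · rw [hpot b hb]
          ring
    _ = y a / t + α * ∑ b, (r b : ℝ) / t * Q b
        + ((t - 1) * μ + (4 * Fintype.card V * α * (t - 1) + (8 * α)⁻¹ * H)) := by
        rw [Finset.sum_add_distrib, Finset.sum_add_distrib, ← Finset.mul_sum, ← Finset.mul_sum,
          hw, hmean, mul_one]
    _ ≤ potential D z μ α r := by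
        have h1 := mul_le_mul_of_nonneg_left hQmean hα.le
        rw [hpotr]
        have h2 : α * ((1 - 2 / t) * ∑ c, d c ^ 2 + 4 * Fintype.card V) =
          α * ∑ c, d c ^ 2 - 2 * α / t * ∑ c, d c ^ 2 + 4 * Fintype.card V * α := by ring
        linarith

theorem expectedScore_proportionalStrategy_le [Nonempty V] (D : Digraph V) {z : V → ℝ} {μ α : ℝ}
    (hz : ∀ a, |z a| ≤ 1) (hμ : ∀ a, z a ≤ μ) (hα : 0 < α) (N : NormanStrategy V) (r : V → ℕ) :
    expectedScore D r N proportionalStrategy ≤ potential D z μ α r := by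
  induction hk : ∑ v, r v using Nat.strong_induction_on generalizing r with
  | _ k ih =>
    by_cases hr : r = 0
    · subst hr
      rw [expectedScore_zero]
      simp only [potential, Pi.zero_apply]
      simp only [Nat.cast_zero, Finset.sum_const_zero, zero_mul, mul_zero, Finset.range_zero,
        Finset.sum_empty, add_zero, zero_add]
      exact mul_nonneg hα.le (Finset.sum_nonneg fun a _ => sq_nonneg _)
    · refine expectedScore_le_of_forall_move D N _ hr fun a => ?_
      refine le_trans (Finset.sum_le_sum fun b _ => ?_) (potential_step D hz hμ hα hr a)
      rw [proportionalStrategy_toReal hr]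
      by_cases hb : r b = 0
      · simp [hb]
      · refine mul_le_mul_of_nonneg_left ?_ (by positivity)
        have := ih _ (hk ▸ sum_sub_single_lt r b hb) (r - Pi.single b 1) rfl
        linarith

theorem valueAgainst_proportionalStrategy_le [Nonempty V] (D : Digraph V) {r : V → ℕ} {m α : ℝ}
    (hm : ∀ a, totalPayoff D r a ≤ m) (hα : 0 < α) (hr : r ≠ 0) :
    valueAgainst D r proportionalStrategy ≤ m + (4 * Fintype.card V * α * (∑ v, (r v : ℝ))
      + (8 * α)⁻¹ * ∑ i ∈ Finset.range (∑ v, r v), ((i : ℝ) + 1)⁻¹) := by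
  have htpos : (0 : ℝ) < ∑ v, (r v : ℝ) := by
    refine lt_of_le_of_ne (by positivity) fun h => hr ?_
    funext v
    have := (Finset.sum_eq_zero_iff_of_nonneg fun v _ => Nat.cast_nonneg (r v)).1 h.symm v
      (Finset.mem_univ v)
    exact_mod_cast this
  refine valueAgainst_le fun N => ?_
  -- With `z` the exact average payoffs at the start, the quadratic term vanishes initially.
  refine (expectedScore_proportionalStrategy_le D (z := fun a => totalPayoff D r a / ∑ v, (r v : ℝ))
    (μ := m / ∑ v, (r v : ℝ)) (fun a => ?_) (fun a => ?_) hα N r).trans ?_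
  · rw [abs_div, abs_of_pos htpos, div_le_one htpos]
    refine (Finset.abs_sum_le_sum_abs _ _).trans (Finset.sum_le_sum fun b _ => ?_)
    rw [abs_mul, Nat.abs_cast]
    exact mul_le_of_le_one_left (Nat.cast_nonneg _) (abs_payoffMatrix_le D a b)
  · exact div_le_div_of_nonneg_right (hm a) htpos.le
  · rw [potential]
    have h1 : ∀ x : ℝ, (∑ v, (r v : ℝ)) * (x / ∑ v, (r v : ℝ)) = x := fun x =>
      mul_div_cancel₀ x htpos.ne'
    simp only [h1, sub_self]
    simp

end Proportional

/-! ### Lower bound: Norman exploits an oblivious strategy -/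

section Lower

variable {V : Type*} [Fintype V] [DecidableEq V]

open Classical in
/-- Norman plays `a` while the support of the restriction vector is `U`, and `w` otherwise. -/
noncomputable def switchStrategy (U : Set V) (a w : V) : NormanStrategy V :=
  fun r => PMF.pure (if Function.support r = U then a else w)

open Classical in
theorem expectedScore_switchStrategy (D : Digraph V) (U : Set V) (a w : V) (R : ReiStrategy V)
    {r : V → ℕ} (hr : r ≠ 0) {c : V} (hc : (if Function.support r = U then a else w) = c) :
    expectedScore D r (switchStrategy U a w) R = ∑ b, (R.play r b).toReal *
      (payoffMatrix D c b + expectedScore D (r - Pi.single b 1) (switchStrategy U a w) R) := by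
  rw [expectedScore_of_ne_zero D _ R hr, Finset.sum_eq_single c]
  · simp [switchStrategy, hc, payoffMatrix]
  · intro c' _ h
    simp [switchStrategy, hc, PMF.pure_apply, h]
  · simp

/-- Rei must use up `r`, so playing `w` throughout yields exactly `totalPayoff D r w`. Each round
with support `U` adds at least `γ`, and there are at least `k` of them, since no option in `U` runs
out sooner. -/
theorem le_expectedScore_switchStrategy (D : Digraph V) {U : Set V} (hU : U.Nonempty) (a w : V)
    {R : ReiStrategy V} {p : V → ℝ}
    (hR : ∀ r, Function.support r = U → ∀ b, (R.play r b).toReal = p b) {γ : ℝ}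
    (hγ0 : 0 ≤ γ)
    (hγ : ∑ b, p b * payoffMatrix D w b + γ ≤ ∑ b, p b * payoffMatrix D a b)
    (r : V → ℕ) (k : ℕ) (hrU : Function.support r ⊆ U) (hk : ∀ b ∈ U, k ≤ r b) :
    totalPayoff D r w + γ * k ≤ expectedScore D r (switchStrategy U a w) R := by
  induction hn : ∑ v, r v using Nat.strong_induction_on generalizing r k with
  | _ n ih =>
    by_cases hr : r = 0
    · subst hr
      obtain ⟨b, hb⟩ := hU
      obtain rfl : k = 0 := Nat.le_zero.1 (hk b hb)
      rw [expectedScore_zero]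
      simp [totalPayoff]
    · have hstep : ∀ c k', (∀ b ∈ U, k' ≤ r b - 1) →
          ∑ b, (R.play r b).toReal * payoffMatrix D c b
            + (totalPayoff D r w - ∑ b, (R.play r b).toReal * payoffMatrix D w b + γ * k') ≤
          ∑ b, (R.play r b).toReal * (payoffMatrix D c b +
            expectedScore D (r - Pi.single b 1) (switchStrategy U a w) R) := by
        intro c k' hk'
        calc _ = ∑ b, (R.play r b).toReal * (payoffMatrix D c b +
              (totalPayoff D r w - payoffMatrix D w b + γ * k')) := by
              simp only [mul_add, mul_sub, Finset.sum_add_distrib, Finset.sum_sub_distrib,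
                ← Finset.sum_mul, sum_toReal, one_mul]
          _ ≤ _ := by
              refine Finset.sum_le_sum fun b _ => ?_
              by_cases hb : R.play r b = 0
              · simp [hb]
              have hb' : r b ≠ 0 := R.support_subset r hr ((PMF.mem_support_iff _ _).2 hb)
              refine mul_le_mul_of_nonneg_left ?_ ENNReal.toReal_nonneg
              rw [← totalPayoff_sub_single D hb']
              refine add_le_add_right (ih _ (hn ▸ sum_sub_single_lt r b hb') _ k' ?_ ?_ rfl) _
              · intro c hc
                refine hrU fun h => hc ?_
                simp [h]
              · intro c hc
                refine (hk' c hc).trans (Nat.sub_le_sub_left ?_ _)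
                by_cases h : c = b
                · subst h; simp
                · simp [h]
      by_cases hs : Function.support r = U
      · rw [expectedScore_switchStrategy D U a w R hr (if_pos hs)]
        refine le_trans ?_ (hstep a (k - 1) fun b hb => Nat.sub_le_sub_right (hk b hb) 1)
        simp only [hR r hs]
        have : γ * k ≤ γ + γ * ((k - 1 : ℕ) : ℝ) := by
          have : (k : ℝ) ≤ 1 + ((k - 1 : ℕ) : ℝ) := by exact_mod_cast (by omega : k ≤ 1 + (k - 1))
          nlinarith
        linarith
      · rw [expectedScore_switchStrategy D U a w R hr (if_neg hs)]
        -- An option of `U` has run out, so no further bonus is claimed.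
        obtain rfl : k = 0 := by
          by_contra hk0
          exact hs (hrU.antisymm fun b hb => by
            have := hk b hb
            rw [Function.mem_support]
            omega)
        refine le_trans ?_ (hstep w 0 fun b _ => Nat.zero_le _)
        linarith

/-- If an oblivious strategy for Rei is optimal, then Norman cannot gain by delaying a move `w`
which maximizes his payoff against the remaining moves. -/
theorem isMax_of_oblivious [Nonempty V] {D : Digraph V} {R : ReiStrategy V} (hopt : R.IsOptimal D)
    (hobl : R.IsOblivious) {r : V → ℕ} (hr : r ≠ 0) {w : V}
    (hw : ∀ a, totalPayoff D r a ≤ totalPayoff D r w) (a : V) :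
    ∑ b, (R.play r b).toReal * payoffMatrix D a b ≤
      ∑ b, (R.play r b).toReal * payoffMatrix D w b := by
  by_contra! hlt
  set p : V → ℝ := fun b => (R.play r b).toReal with hp
  set γ := ∑ b, p b * payoffMatrix D a b - ∑ b, p b * payoffMatrix D w b with hγdef
  have hγ : 0 < γ := sub_pos.2 hlt
  set T : ℕ := ∑ v, r v with hT
  have hTpos : (0 : ℝ) < T := by
    refine Nat.cast_pos.2 (Nat.pos_of_ne_zero fun h => hr ?_)
    funext v
    exact (Finset.sum_eq_zero_iff.1 h) v (Finset.mem_univ v)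
  have hVpos : (0 : ℝ) < Fintype.card V := Nat.cast_pos.2 Fintype.card_pos
  -- Chosen so that the linear error `4 |V| α (M T)` equals `γ M / 4`; it does not depend on `M`.
  set α : ℝ := γ / (16 * Fintype.card V * T) with hα
  have hαpos : 0 < α := by positivity
  have hscale : ∀ (M : ℕ) c, totalPayoff D (M • r) c = M * totalPayoff D r c := by
    intro M c
    simp only [totalPayoff, Pi.smul_apply, smul_eq_mul, Nat.cast_mul, Finset.mul_sum]
    exact Finset.sum_congr rfl fun b _ => by ring
  have hsum : ∀ M : ℕ, ∑ v, (M • r) v = M * T := by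
    intro M
    simp [hT, Finset.mul_sum]
  have hmain : ∀ M : ℕ, 0 < M → γ * M ≤ γ / 4 * M
      + (8 * α)⁻¹ * ∑ i ∈ Finset.range (M * T), ((i : ℝ) + 1)⁻¹ := by
    intro M hM
    have hMr : Function.support (M • r) = Function.support r := by
      ext v
      simp [hM.ne']
    have hMr0 : M • r ≠ 0 := smul_ne_zero hM.ne' hr
    have h1 := le_expectedScore_switchStrategy D (U := Function.support r)
      (Function.support_nonempty_iff.2 hr) a w (R := R) (p := p)
      (fun r' hr' b => by rw [hobl r' r hr']) hγ.le (by rw [hγdef]; linarith) (M • r) M hMr.le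
      (fun b hb => Nat.le_mul_of_pos_right M (Nat.pos_of_ne_zero hb))
    have h2 := expectedScore_le_valueAgainst D (M • r) (switchStrategy (Function.support r) a w) R
    have h3 := (hopt (M • r)).ge.trans (value_le_valueAgainst D (M • r) proportionalStrategy)
    have h4 := valueAgainst_proportionalStrategy_le D (r := M • r)
      (m := totalPayoff D (M • r) w) (fun c => by
        rw [hscale, hscale]
        exact mul_le_mul_of_nonneg_left (hw c) (Nat.cast_nonneg M)) hαpos hMr0
    rw [← Nat.cast_sum, hsum] at h4
    have h5 : 4 * (Fintype.card V : ℝ) * α * ((M * T : ℕ) : ℝ) = γ / 4 * M := by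
      rw [hα]
      push_cast
      field_simp
      norm_num
    rw [h5] at h4
    linarith
  -- The harmonic sum is a Cesàro sum of a null sequence, so for large `M` the other error is also
  -- below `γ M / 4`.
  have hlim : Filter.Tendsto (fun n : ℕ => (n : ℝ)⁻¹ * ∑ i ∈ Finset.range n, ((i : ℝ) + 1)⁻¹)
      Filter.atTop (nhds 0) := by
    have h := tendsto_one_div_add_atTop_nhds_zero_nat (𝕜 := ℝ)
    simp only [one_div] at h
    exact h.cesaro
  have hev := (tendsto_order.1 hlim).2 (2 * α * γ / T) (by positivity)
  obtain ⟨n₀, hn₀⟩ := Filter.eventually_atTop.1 hev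
  have hM := hmain (n₀ + 1) n₀.succ_pos
  have hT1 : 1 ≤ T := by exact_mod_cast hTpos
  have hn := hn₀ ((n₀ + 1) * T) (by nlinarith)
  set H := ∑ i ∈ Finset.range ((n₀ + 1) * T), ((i : ℝ) + 1)⁻¹
  have hMpos : (0 : ℝ) < ((n₀ + 1 : ℕ) : ℝ) := by positivity
  rw [Nat.cast_mul, inv_mul_lt_iff₀ (by positivity)] at hn
  have h6 : ((n₀ + 1 : ℕ) : ℝ) * T * (2 * α * γ / T) = 8 * α * (γ / 4 * (n₀ + 1 : ℕ)) := by
    field_simp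
    norm_num
  rw [h6] at hn
  have h7 : (8 * α)⁻¹ * H < γ / 4 * (n₀ + 1 : ℕ) := by
    rwa [inv_mul_lt_iff₀ (by positivity)]
  nlinarith [mul_pos hγ hMpos]

end Lower

/-! ### Oblivious Eulerian tournaments have almost nested out-neighbourhoods -/

section Tournament

variable {V : Type*} {D : Digraph V}

theorem IsTournament.not_adj (hT : IsTournament D) {u v : V} (h : D.Adj u v) : ¬ D.Adj v u := by
  by_cases huv : u = v
  · subst huv
    exact hT.1 u
  · exact (hT.2 u v huv).1 h

theorem IsTournament.adj_or_adj (hT : IsTournament D) {u v : V} (huv : u ≠ v) :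
    D.Adj u v ∨ D.Adj v u := by
  have := hT.2 u v huv
  tauto

open Classical in
theorem payoff_eq (D : Digraph V) (u v : V) :
    payoff D u v = if D.Adj u v then 1 else if D.Adj v u then -1 else 0 := rfl

theorem payoffMatrix_of_adj {u v : V} (h : D.Adj u v) : payoffMatrix D u v = 1 := by
  simp [payoffMatrix, payoff_eq, h]

theorem payoffMatrix_swap (hT : IsTournament D) (u v : V) :
    payoffMatrix D u v = - payoffMatrix D v u := by
  simp only [payoffMatrix, payoff_eq]
  have h1 := @IsTournament.not_adj _ _ hT u v
  by_cases h2 : D.Adj u v <;> by_cases h3 : D.Adj v u <;> simp_all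

theorem payoffMatrix_nonpos {u v : V} (h : ¬ D.Adj u v) :
    payoffMatrix D u v ≤ 0 := by
  simp only [payoffMatrix, payoff_eq, if_neg h]
  split_ifs <;> simp

variable [Fintype V]

theorem sum_payoffMatrix (hT : IsTournament D) (hE : IsEulerian D) (u : V) :
    ∑ v, payoffMatrix D u v = 0 := by
  classical
  have h : ∀ v, payoffMatrix D u v =
      (if v ∈ outNbhd D u then 1 else 0) - (if v ∈ inNbhd D u then 1 else 0) := by
    intro v
    rw [payoffMatrix, payoff_eq]
    change _ = (if D.Adj u v then (1 : ℝ) else 0) - (if D.Adj v u then 1 else 0)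
    have h1 := @IsTournament.not_adj _ _ hT u v
    by_cases h2 : D.Adj u v <;> by_cases h3 : D.Adj v u <;> simp_all
  have hE' := hE u
  rw [Set.ncard_eq_toFinset_card', Set.ncard_eq_toFinset_card'] at hE'
  simp only [h, Finset.sum_sub_distrib, Finset.sum_boole]
  rw [sub_eq_zero]
  norm_cast
  convert hE' using 2 <;> · ext; simp

/-- Deleting a vertex from an Eulerian tournament yields a non-singular skew matrix. -/
theorem eq_zero_of_payoffMatrix_mulVec_eq_zero (hT : IsTournament D) {p : V → ℝ} {v : V}
    (hv : p v = 0) (hp : ∀ a, ∑ b, payoffMatrix D a b * p b = 0) : p = 0 := by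
  classical
  -- The extra entry at `(v, v)` is invisible to `p`, because `p v = 0`. Modulo 2 the matrix is all
  -- ones off the diagonal, whatever the tournament, with diagonal zero except at `v`, and it is
  -- invertible.
  set M : Matrix V V ℤ := Matrix.of fun a b => payoff D a b + if a = v ∧ b = v then 1 else 0 with hM
  have hmod : ∀ a b, ((payoff D a b : ℤ) : ZMod 2) = if a = b then 0 else 1 := by
    intro a b
    simp only [payoff_eq]
    by_cases hab : a = b
    · subst hab
      simp [hT.1 a]
    · rcases hT.adj_or_adj hab with h | h
      · simp [h, hab]
      · simp only [h, hT.not_adj h, hab, if_true, if_false]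
        decide
  have hdet2 : (M.map (Int.castRingHom (ZMod 2))).det ≠ 0 := by
    rw [Ne, ← Matrix.exists_mulVec_eq_zero_iff]
    rintro ⟨x, hx0, hx⟩
    apply hx0
    have hrow : ∀ a, ∑ b, x b - x a + (if a = v then x v else 0) = 0 := by
      intro a
      have h := congrFun hx a
      simp only [Matrix.mulVec, dotProduct, Matrix.map_apply, hM, Matrix.of_apply,
        Int.coe_castRingHom, Int.cast_add, hmod, Pi.zero_apply, add_mul,
        Finset.sum_add_distrib] at h
      have h1 : ∑ b, (if a = b then (0 : ZMod 2) else 1) * x b = ∑ b, x b - x a := by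
        rw [eq_sub_iff_add_eq, ← Finset.sum_erase_add _ _ (Finset.mem_univ a)]
        simp only [if_true, zero_mul, add_zero]
        rw [← Finset.sum_erase_add Finset.univ x (Finset.mem_univ a)]
        congr 1
        refine Finset.sum_congr rfl fun b hb => ?_
        rw [if_neg (Finset.ne_of_mem_erase hb).symm, one_mul]
      have h2 : ∑ b, ((if a = v ∧ b = v then 1 else 0 : ℤ) : ZMod 2) * x b
          = if a = v then x v else 0 := by
        by_cases hav : a = v <;> simp [hav]
      rwa [h1, h2] at h
    have hs : ∑ b, x b = 0 := by
      have := hrow v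
      simpa using this
    have hne : ∀ a, a ≠ v → x a = 0 := by
      intro a ha
      have := hrow a
      simpa [hs, ha] using this
    have hxv : x v = 0 := by
      rw [← hs]
      exact (Finset.sum_eq_single v (fun b _ hb => hne b hb) (by simp)).symm
    funext a
    by_cases ha : a = v
    · rw [ha, hxv]; rfl
    · exact hne a ha
  have hdet : M.det ≠ 0 := by
    intro h
    apply hdet2
    rw [← RingHom.mapMatrix_apply, ← RingHom.map_det, h, map_zero]
  have hdetR : (M.map (Int.castRingHom ℝ)).det ≠ 0 := by
    rw [← RingHom.mapMatrix_apply, ← RingHom.map_det]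
    simpa using hdet
  by_contra hp0
  refine hdetR (Matrix.exists_mulVec_eq_zero_iff.1 ⟨p, hp0, ?_⟩)
  funext a
  simp only [Matrix.mulVec, dotProduct, Matrix.map_apply, hM, Matrix.of_apply,
    Int.coe_castRingHom, Int.cast_add, Pi.zero_apply, add_mul, Finset.sum_add_distrib]
  rw [show ∑ b, ((payoff D a b : ℤ) : ℝ) * p b = 0 from hp a, zero_add]
  refine Finset.sum_eq_zero fun b _ => ?_
  by_cases hb : b = v
  · rw [hb, hv, mul_zero]
  · simp [hb]

/-- In an oblivious Eulerian tournament some out-neighbourhood contains another one up to any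
prescribed vertex. -/
theorem exists_outNbhd_diff_subset [DecidableEq V] (hT : IsTournament D) (hE : IsEulerian D)
    (hD : IsObliviousDigraph D) [Nontrivial V] (v : V) :
    ∃ a w, a ≠ w ∧ outNbhd D w \ outNbhd D a ⊆ {v} := by
  classical
  by_contra! hcon
  obtain ⟨R, hopt, hobl⟩ := hD
  -- Rows of the payoff matrix sum to zero, so the constant part `1` contributes only the correction
  -- at `v`, while the excess `2` rewards beating `N⁺(w) \ {v}`.
  let r : V → V → ℕ := fun w b => if b = v then 0 else if D.Adj w b then 3 else 1
  have hsupp : ∀ w, Function.support (r w) = {v}ᶜ := by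
    intro w
    ext b
    by_cases hb : b = v
    · simp [r, hb]
    · by_cases h : D.Adj w b <;> simp [r, hb, h]
  obtain ⟨u, hu⟩ := exists_ne v
  have hr0 : ∀ w, r w ≠ 0 := by
    intro w
    rw [← Function.support_nonempty_iff, hsupp]
    exact ⟨u, hu⟩
  have htotal : ∀ w c, totalPayoff D (r w) c = - payoffMatrix D c v
      + 2 * ∑ b ∈ Finset.univ.filter (fun b => b ≠ v ∧ D.Adj w b), payoffMatrix D c b := by
    intro w c
    have h0 := sum_payoffMatrix hT hE c
    have h1 : ∀ b, payoffMatrix D c b * r w b = payoffMatrix D c b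
        - (if b = v then payoffMatrix D c b else 0)
        + 2 * (if b ≠ v ∧ D.Adj w b then payoffMatrix D c b else 0) := by
      intro b
      by_cases hb : b = v
      · simp [r, hb]
      · by_cases h : D.Adj w b
        · simp [r, hb, h]; ring
        · simp [r, hb, h]
    rw [totalPayoff, Finset.sum_filter]
    simp only [h1, Finset.sum_add_distrib, Finset.sum_sub_distrib, h0, ← Finset.mul_sum]
    simp
  have hmax : ∀ w a, totalPayoff D (r w) a ≤ totalPayoff D (r w) w := by
    intro w a
    -- Missing one vertex of `N⁺(w) \ {v}` costs `a` at least `2`, and the payoffs against `v` can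
    -- make up for at most `2`.
    rcases eq_or_ne a w with rfl | haw
    · exact le_rfl
    obtain ⟨b₀, ⟨hb₀, hab₀⟩, hb₀v⟩ := Set.not_subset.1 (hcon a w haw)
    set X := Finset.univ.filter (fun b => b ≠ v ∧ D.Adj w b) with hX
    have hmem : b₀ ∈ X := by
      simp only [hX, Finset.mem_filter, Finset.mem_univ, true_and]
      exact ⟨hb₀v, hb₀⟩
    rw [htotal, htotal, ← hX]
    have h1 : ∑ b ∈ X, payoffMatrix D w b = X.card := by
      rw [Finset.sum_congr rfl fun b hb => payoffMatrix_of_adj (Finset.mem_filter.1 hb).2.2]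
      simp
    have h2 : ∑ b ∈ X, payoffMatrix D a b ≤ X.card - 1 := by
      rw [← Finset.sum_erase_add _ _ hmem]
      have h3 : ∑ b ∈ X.erase b₀, payoffMatrix D a b ≤ ∑ b ∈ X.erase b₀, 1 :=
        Finset.sum_le_sum fun b _ => (abs_le.1 (abs_payoffMatrix_le D a b)).2
      have h4 := payoffMatrix_nonpos hab₀
      have h5 : ((X.erase b₀).card : ℝ) = X.card - 1 := Finset.cast_card_erase_of_mem hmem
      simp only [Finset.sum_const, nsmul_eq_mul, mul_one, h5] at h3
      linarith
    have h6 := (abs_le.1 (abs_payoffMatrix_le D a v)).1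
    have h7 := (abs_le.1 (abs_payoffMatrix_le D w v)).2
    linarith
  set p : V → ℝ := fun b => (R.play (r v) b).toReal with hp
  have hpr : ∀ w b, (R.play (r w) b).toReal = p b := by
    intro w b
    rw [hobl (r w) (r v) (by rw [hsupp, hsupp])]
  have hle : ∀ a w, ∑ b, p b * payoffMatrix D a b ≤ ∑ b, p b * payoffMatrix D w b := by
    intro a w
    have := isMax_of_oblivious hopt hobl (hr0 w) (hmax w) a
    simpa only [hpr] using this
  -- By skew symmetry column sums vanish too, so the common payoff of all moves against `p` is zero.
  have hsum : ∑ a, ∑ b, p b * payoffMatrix D a b = 0 := by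
    rw [Finset.sum_comm]
    refine Finset.sum_eq_zero fun b _ => ?_
    rw [← Finset.mul_sum, Finset.sum_congr rfl fun a _ => payoffMatrix_swap hT a b,
      Finset.sum_neg_distrib, sum_payoffMatrix hT hE]
    simp
  have hzero : ∀ a, ∑ b, payoffMatrix D a b * p b = 0 := by
    intro a
    have h1 : ∑ c, ∑ b, p b * payoffMatrix D c b
        = Fintype.card V * ∑ b, p b * payoffMatrix D a b := by
      rw [Finset.sum_congr rfl fun c _ => (hle c a).antisymm (hle a c)]
      simp
    rw [hsum, zero_eq_mul] at h1
    rcases h1 with h1 | h1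
    · exact absurd h1 (Nat.cast_ne_zero.2 Fintype.card_ne_zero)
    · simpa only [mul_comm] using h1
  have hpv : p v = 0 := by
    by_contra h
    have h' : R.play (r v) v ≠ 0 := fun h0 => h (by simp [hp, h0])
    have := R.support_subset (r v) (hr0 v) ((PMF.mem_support_iff _ _).2 h')
    rw [hsupp] at this
    exact this rfl
  have h0 := eq_zero_of_payoffMatrix_mulVec_eq_zero hT hpv hzero
  have h1 := sum_toReal (R.play (r v))
  rw [show ∑ a, (R.play (r v) a).toReal = ∑ a, p a from rfl, h0] at h1
  simp at h1

end Tournament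

/-! ### Reversing the arcs inside a vertex set -/

section Reversal

variable {V : Type*} [DecidableEq V]

/-- The digraph obtained by reversing all arcs inside `S`. -/
def reverseOn (D : Digraph V) (S : Finset V) : Digraph V :=
  ⟨fun u v => if u ∈ S ∧ v ∈ S then D.Adj v u else D.Adj u v⟩

theorem reverseOn_adj {D : Digraph V} {S : Finset V} {u v : V} :
    (reverseOn D S).Adj u v ↔ if u ∈ S ∧ v ∈ S then D.Adj v u else D.Adj u v := Iff.rfl

theorem reverseOn_reverseOn (D : Digraph V) (S : Finset V) : reverseOn (reverseOn D S) S = D := by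
  ext u v
  simp only [reverseOn_adj]
  by_cases h : u ∈ S ∧ v ∈ S <;> simp [h]

theorem isTournament_reverseOn {D : Digraph V} (hT : IsTournament D) (S : Finset V) :
    IsTournament (reverseOn D S) := by
  refine ⟨fun v => ?_, fun u v huv => ?_⟩
  · simp [reverseOn_adj, hT.1 v]
  · simp only [reverseOn_adj]
    by_cases h : u ∈ S ∧ v ∈ S
    · rw [if_pos h, if_pos h.symm]
      exact hT.2 v u huv.symm
    · rw [if_neg h, if_neg fun h' => h h'.symm]
      exact hT.2 u v huv

end Reversal

/-! ### Cyclic triangle switchings and the number available -/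

section Switching

variable {V : Type*} [Fintype V]

open Classical in
/-- The out-neighbourhood as a `Finset`. -/
noncomputable def outFinset (D : Digraph V) (u : V) : Finset V :=
  Finset.univ.filter fun v => D.Adj u v

open Classical in
/-- The in-neighbourhood as a `Finset`. -/
noncomputable def inFinset (D : Digraph V) (u : V) : Finset V :=
  Finset.univ.filter fun v => D.Adj v u

theorem mem_outFinset {D : Digraph V} {u v : V} : v ∈ outFinset D u ↔ D.Adj u v := by
  simp [outFinset]

theorem mem_inFinset {D : Digraph V} {u v : V} : v ∈ inFinset D u ↔ D.Adj v u := by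
  simp [inFinset]

theorem coe_outFinset (D : Digraph V) (u : V) : (outFinset D u : Set V) = outNbhd D u := by
  ext
  simp [mem_outFinset, outNbhd]

theorem coe_inFinset (D : Digraph V) (u : V) : (inFinset D u : Set V) = inNbhd D u := by
  ext
  simp [mem_inFinset, inNbhd]

variable [DecidableEq V]

theorem card_outFinset_add_card_inFinset {D : Digraph V} (hT : IsTournament D) (u : V) :
    (outFinset D u).card + (inFinset D u).card + 1 = Fintype.card V := by
  have h1 : Disjoint (outFinset D u) (inFinset D u) :=
    Finset.disjoint_left.2 fun v h h' => hT.not_adj (mem_outFinset.1 h) (mem_inFinset.1 h')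
  have h2 : outFinset D u ∪ inFinset D u = Finset.univ.erase u := by
    ext v
    simp only [Finset.mem_union, mem_outFinset, mem_inFinset, Finset.mem_erase, Finset.mem_univ,
      and_true]
    constructor
    · rintro h rfl
      exact hT.1 v (h.elim id id)
    · exact fun h => hT.adj_or_adj h.symm
  rw [← Finset.card_union_of_disjoint h1, h2, Finset.card_erase_add_one (Finset.mem_univ u),
    Finset.card_univ]

theorem isEulerian_iff_card_outFinset {D : Digraph V} (hT : IsTournament D) {n : ℕ}
    (hn : Fintype.card V = 2 * n + 1) : IsEulerian D ↔ ∀ u, (outFinset D u).card = n := by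
  refine forall_congr' fun u => ?_
  rw [← coe_outFinset, ← coe_inFinset, Set.ncard_coe_finset, Set.ncard_coe_finset]
  have := card_outFinset_add_card_inFinset hT u
  omega

theorem outFinset_reverseOn_of_notMem {D : Digraph V} {S : Finset V} {u : V} (hu : u ∉ S) :
    outFinset (reverseOn D S) u = outFinset D u := by
  ext v
  simp [mem_outFinset, reverseOn_adj, hu]

theorem outFinset_reverseOn_triangle {D : Digraph V} (hT : IsTournament D) {u v w : V}
    (huv : D.Adj u v) (hwu : D.Adj w u) :
    outFinset (reverseOn D {u, v, w}) u = insert w ((outFinset D u).erase v) := by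
  ext t
  have h1 := hT.1 u
  have h2 := hT.not_adj huv
  have h3 := hT.not_adj hwu
  simp only [mem_outFinset, reverseOn_adj, Finset.mem_insert, Finset.mem_singleton, true_or,
    true_and, Finset.mem_erase]
  by_cases htu : t = u
  · subst htu
    have : t ≠ w := fun h => h1 (h ▸ hwu)
    simp [h1, this]
  by_cases htv : t = v
  · subst htv
    have : t ≠ w := fun h => h3 (h ▸ huv)
    simp [h2, this]
  by_cases htw : t = w
  · subst htw
    simp [hwu]
  · simp [htu, htv, htw]

theorem card_outFinset_reverseOn_triangle {D : Digraph V} (hT : IsTournament D) {u v w : V}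
    (huv : D.Adj u v) (hwu : D.Adj w u) :
    (outFinset (reverseOn D {u, v, w}) u).card = (outFinset D u).card := by
  rw [outFinset_reverseOn_triangle hT huv hwu, Finset.card_insert_of_notMem,
    Finset.card_erase_add_one (mem_outFinset.2 huv)]
  exact fun h => hT.not_adj hwu (mem_outFinset.1 (Finset.mem_of_mem_erase h))

/-- Each vertex of the cyclic triangle trades its successor for its predecessor, so out-degrees are
preserved. -/
theorem isEulerian_reverseOn_triangle {D : Digraph V} (hT : IsTournament D) (hE : IsEulerian D)
    {n : ℕ} (hn : Fintype.card V = 2 * n + 1) {u v w : V}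
    (huv : D.Adj u v) (hvw : D.Adj v w) (hwu : D.Adj w u) :
    IsEulerian (reverseOn D {u, v, w}) := by
  rw [isEulerian_iff_card_outFinset (isTournament_reverseOn hT _) hn]
  rw [isEulerian_iff_card_outFinset hT hn] at hE
  intro t
  rw [← hE t]
  have hrot : ∀ x y z : V, ({x, y, z} : Finset V) = {y, z, x} := by
    intro x y z
    ext
    simp only [Finset.mem_insert, Finset.mem_singleton]
    tauto
  by_cases ht : t ∈ ({u, v, w} : Finset V)
  · simp only [Finset.mem_insert, Finset.mem_singleton] at ht
    rcases ht with rfl | rfl | rfl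
    · exact card_outFinset_reverseOn_triangle hT huv hwu
    · rw [hrot]
      exact card_outFinset_reverseOn_triangle hT hvw huv
    · rw [hrot, hrot]
      exact card_outFinset_reverseOn_triangle hT hwu hvw
  · rw [outFinset_reverseOn_of_notMem ht]

open Classical in
/-- The arcs `x → y` from a common out-neighbour `x` of `a` and `w` to a common in-neighbour `y`. -/
noncomputable def crossingArcs (D : Digraph V) (a w : V) : Finset (V × V) :=
  ((outFinset D a ∩ outFinset D w) ×ˢ (inFinset D a ∩ inFinset D w)).filter fun p => D.Adj p.1 p.2

theorem mem_crossingArcs {D : Digraph V} {a w : V} {p : V × V} : p ∈ crossingArcs D a w ↔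
    ((D.Adj a p.1 ∧ D.Adj w p.1) ∧ D.Adj p.2 a ∧ D.Adj p.2 w) ∧ D.Adj p.1 p.2 := by
  simp [crossingArcs, mem_outFinset, mem_inFinset]

theorem two_mul_sum_card_inter_le {D : Digraph V} (hT : IsTournament D) (X : Finset V) :
    2 * ∑ x ∈ X, (outFinset D x ∩ X).card ≤ X.card ^ 2 := by
  classical
  have h1 : ∀ x, (outFinset D x ∩ X).card = ∑ y ∈ X, if D.Adj x y then 1 else 0 := by
    intro x
    rw [← Finset.card_filter]
    congr 1
    ext y
    simp [mem_outFinset, and_comm]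
  simp only [h1]
  calc _ = ∑ x ∈ X, ∑ y ∈ X, ((if D.Adj x y then 1 else 0) + if D.Adj y x then 1 else 0) := by
        simp only [Finset.sum_add_distrib]
        rw [two_mul]
        congr 1
        exact Finset.sum_comm
    _ ≤ ∑ x ∈ X, ∑ y ∈ X, 1 := by
        refine Finset.sum_le_sum fun x _ => Finset.sum_le_sum fun y _ => ?_
        have := @IsTournament.not_adj _ _ hT x y
        split_ifs <;> simp_all
    _ = X.card ^ 2 := by simp [sq]

/-- Nearly all vertices lie in the common out-neighbourhood `X` or the common in-neighbourhood `Y`,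
with `|X|` close to `n`. Out-degrees in `X` total `n |X|`, at most `|X|² / 2` of these arcs stay
inside `X`, and all but `O(n)` of the others end in `Y`. This leaves about `n² / 2` arcs; `28 ≤ n`
absorbs the linear loss into the factor `4`. -/
theorem sq_le_card_crossingArcs {D : Digraph V} (hT : IsTournament D) {n : ℕ}
    (hD : ∀ u, (outFinset D u).card = n) (hn : 28 ≤ n) {a w : V}
    (h : (outFinset D w \ outFinset D a).card ≤ 2) : n ^ 2 ≤ 4 * (crossingArcs D a w).card := by
  classical
  set X := outFinset D a ∩ outFinset D w with hX
  set Y := inFinset D a ∩ inFinset D w with hY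
  have h' : (outFinset D a \ outFinset D w).card ≤ 2 := by
    rwa [Finset.card_sdiff_comm ((hD a).trans (hD w).symm)]
  have hXle : X.card ≤ n := (Finset.card_le_card Finset.inter_subset_left).trans (hD a).le
  have hXge : n ≤ X.card + 2 := by
    have := Finset.card_inter_add_card_sdiff (outFinset D a) (outFinset D w)
    rw [hD a, ← hX] at this
    omega
  -- At most two vertices in each of the two differences, and `a`, `w` themselves.
  have hrest : ((X ∪ Y)ᶜ).card ≤ 6 := by
    have hsub : (X ∪ Y)ᶜ ⊆
        (outFinset D w \ outFinset D a ∪ outFinset D a \ outFinset D w) ∪ {a, w} := by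
      intro u hu
      by_cases hua : u = a
      · simp [hua]
      by_cases huw : u = w
      · simp [huw]
      have h1 := hT.adj_or_adj hua
      have h2 := hT.adj_or_adj huw
      simp only [hX, hY, Finset.mem_compl, Finset.mem_union, Finset.mem_inter, Finset.mem_sdiff,
        mem_outFinset, mem_inFinset, Finset.mem_insert, Finset.mem_singleton] at hu ⊢
      tauto
    have h1 := Finset.card_le_card hsub
    have h2 := Finset.card_union_le (outFinset D w \ outFinset D a ∪ outFinset D a \ outFinset D w)
      {a, w}
    have h3 := Finset.card_union_le (outFinset D w \ outFinset D a) (outFinset D a \ outFinset D w)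
    have h4 := Finset.card_le_two (a := a) (b := w)
    omega
  have hcard : (crossingArcs D a w).card = ∑ x ∈ X, (outFinset D x ∩ Y).card := by
    rw [crossingArcs, Finset.card_filter, Finset.sum_product]
    refine Finset.sum_congr rfl fun x _ => ?_
    rw [← Finset.card_filter]
    congr 1
    ext y
    simp [mem_outFinset, and_comm, hY]
  have hdeg : ∀ x ∈ X, n ≤ (outFinset D x ∩ X).card + (outFinset D x ∩ Y).card + 6 := by
    intro x _
    have hsub : outFinset D x ⊆ (outFinset D x ∩ X ∪ outFinset D x ∩ Y) ∪ (X ∪ Y)ᶜ := by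
      intro u hu
      simp only [Finset.mem_union, Finset.mem_inter, Finset.mem_compl]
      tauto
    have h1 := Finset.card_le_card hsub
    have h2 := Finset.card_union_le (outFinset D x ∩ X ∪ outFinset D x ∩ Y) (X ∪ Y)ᶜ
    have h3 := Finset.card_union_le (outFinset D x ∩ X) (outFinset D x ∩ Y)
    rw [hD x] at h1
    omega
  have hsum := Finset.sum_le_sum hdeg
  simp only [Finset.sum_add_distrib, Finset.sum_const, smul_eq_mul, ← hcard] at hsum
  have hint := two_mul_sum_card_inter_le hT X
  obtain ⟨j, hj⟩ := Nat.exists_eq_add_of_le hXge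
  obtain ⟨m, rfl⟩ := Nat.exists_eq_add_of_le hn
  have hj2 : j ≤ 2 := by omega
  have hXc : X.card = 26 + m + j := by omega
  rw [hXc] at hsum hint
  nlinarith

end Switching

/-! ### Double counting and the union bound -/

section Counting

open Classical in
/-- The Eulerian tournaments in which at most `k` out-neighbours of `w` are not out-neighbours
of `a`. -/
noncomputable def almostNested (n k : ℕ) (a w : Fin (2 * n + 1)) :
    Finset (Digraph (Fin (2 * n + 1))) :=
  (eulerianTournaments n).filter fun D => (outFinset D w \ outFinset D a).card ≤ k

theorem mem_eulerianTournaments {n : ℕ} {D : Digraph (Fin (2 * n + 1))} :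
    D ∈ eulerianTournaments n ↔ IsTournament D ∧ IsEulerian D := by
  simp [eulerianTournaments]

theorem mem_almostNested {n k : ℕ} {a w : Fin (2 * n + 1)} {D : Digraph (Fin (2 * n + 1))} :
    D ∈ almostNested n k a w ↔ (IsTournament D ∧ IsEulerian D) ∧
      (outFinset D w \ outFinset D a).card ≤ k := by
  simp [almostNested, mem_eulerianTournaments]

theorem card_outFinset_of_isEulerian {n : ℕ} {D : Digraph (Fin (2 * n + 1))}
    (hT : IsTournament D) (hE : IsEulerian D) (u : Fin (2 * n + 1)) : (outFinset D u).card = n :=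
  (isEulerian_iff_card_outFinset hT (Fintype.card_fin _)).1 hE u

/-- Reversing the triangle `a → x → y → a` along a crossing arc makes `a` lose `x` and gain `y`
while `N⁺(w)` is unchanged. Each tournament offers at least `n² / 4` such switchings, and each
result arises in at most `(k + 1)²` ways, as `x` and `y` now lie in the two differences. -/
theorem sq_mul_card_almostNested_le {n k : ℕ} (hn : 28 ≤ n) (hk : k ≤ 2)
    {a w : Fin (2 * n + 1)} (haw : a ≠ w) :
    n ^ 2 * (almostNested n k a w).card ≤ 4 * (k + 1) ^ 2 * (almostNested n (k + 1) a w).card := by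
  classical
  let s := (almostNested n k a w).sigma fun D => crossingArcs D a w
  let t := (almostNested n (k + 1) a w).sigma fun D =>
    (outFinset D w \ outFinset D a) ×ˢ (outFinset D a \ outFinset D w)
  let f : (Σ _ : Digraph (Fin (2 * n + 1)), Fin (2 * n + 1) × Fin (2 * n + 1)) →
      (Σ _ : Digraph (Fin (2 * n + 1)), Fin (2 * n + 1) × Fin (2 * n + 1)) :=
    fun q => ⟨reverseOn q.1 {a, q.2.1, q.2.2}, q.2⟩
  have hst : s.card ≤ t.card := by
    refine Finset.card_le_card_of_injOn f ?_ ?_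
    · rintro ⟨D, x, y⟩ hq
      simp only [s, Finset.mem_coe, Finset.mem_sigma, mem_almostNested, mem_crossingArcs] at hq
      obtain ⟨⟨⟨hT, hE⟩, hc⟩, ⟨⟨hax, hwx⟩, hya, hyw⟩, hxy⟩ := hq
      have hw : w ∉ ({a, x, y} : Finset (Fin (2 * n + 1))) := by
        simp only [Finset.mem_insert, Finset.mem_singleton, not_or]
        refine ⟨haw.symm, ?_, ?_⟩
        · rintro rfl
          exact hT.1 _ hwx
        · rintro rfl
          exact hT.1 _ hyw
      have hT' := isTournament_reverseOn hT {a, x, y}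
      have hE' := isEulerian_reverseOn_triangle hT hE (Fintype.card_fin _) hax hxy hya
      have h1 : outFinset (reverseOn D {a, x, y}) w = outFinset D w :=
        outFinset_reverseOn_of_notMem hw
      have h2 := outFinset_reverseOn_triangle hT hax hya
      have hyne : y ≠ x := fun h => hT.1 x (h ▸ hxy)
      simp only [t, f, Finset.mem_coe, Finset.mem_sigma, mem_almostNested, Finset.mem_product,
        h1, h2]
      refine ⟨⟨⟨hT', hE'⟩, ?_⟩, ?_, ?_⟩
      · have hsub : outFinset D w \ insert y ((outFinset D a).erase x) ⊆
            insert x (outFinset D w \ outFinset D a) := by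
          intro u hu
          simp only [Finset.mem_sdiff, Finset.mem_insert, Finset.mem_erase] at hu ⊢
          tauto
        exact (Finset.card_le_card hsub).trans ((Finset.card_insert_le _ _).trans (by omega))
      · simp only [Finset.mem_sdiff, mem_outFinset, Finset.mem_insert, Finset.mem_erase]
        exact ⟨hwx, by tauto⟩
      · simp only [Finset.mem_sdiff, mem_outFinset, Finset.mem_insert, true_or, true_and]
        exact hT.not_adj hyw
    · rintro ⟨D, p⟩ _ ⟨D', p'⟩ _ h
      -- The image records `x` and `y`, and reversal is an involution.
      simp only [f, Sigma.mk.injEq, heq_eq_eq] at h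
      obtain ⟨h, rfl⟩ := h
      rw [← reverseOn_reverseOn D {a, p.1, p.2}, h, reverseOn_reverseOn]
  have hs : n ^ 2 * (almostNested n k a w).card ≤ 4 * s.card := by
    rw [Finset.card_sigma, Finset.mul_sum, mul_comm, ← smul_eq_mul]
    refine Finset.card_nsmul_le_sum _ _ _ fun D hD => ?_
    obtain ⟨⟨hT, hE⟩, hc⟩ := mem_almostNested.1 hD
    exact sq_le_card_crossingArcs hT (card_outFinset_of_isEulerian hT hE) hn (hc.trans hk)
  have ht : t.card ≤ (k + 1) ^ 2 * (almostNested n (k + 1) a w).card := by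
    rw [Finset.card_sigma]
    refine (Finset.sum_le_card_nsmul _ _ ((k + 1) ^ 2) fun D hD => ?_).trans_eq
      ((smul_eq_mul _ _).trans (mul_comm _ _))
    obtain ⟨⟨hT, hE⟩, hc⟩ := mem_almostNested.1 hD
    have hdeg := card_outFinset_of_isEulerian hT hE
    -- Equal out-degrees give the two differences the same size.
    rw [Finset.card_product, sq,
      Finset.card_sdiff_comm (s := outFinset D a) ((hdeg a).trans (hdeg w).symm)]
    exact Nat.mul_le_mul hc hc
  calc _ ≤ 4 * s.card := hs
    _ ≤ 4 * t.card := Nat.mul_le_mul_left 4 hst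
    _ ≤ _ := by rw [mul_assoc]; exact Nat.mul_le_mul_left 4 ht

theorem pow_four_mul_card_almostNested_le {n : ℕ} (hn : 28 ≤ n) {a w : Fin (2 * n + 1)}
    (haw : a ≠ w) :
    n ^ 4 * (almostNested n 1 a w).card ≤ 576 * (eulerianTournaments n).card := by
  have h1 := sq_mul_card_almostNested_le hn (k := 1) (by norm_num) haw
  have h2 := sq_mul_card_almostNested_le hn (k := 2) (by norm_num) haw
  have h3 : (almostNested n 3 a w).card ≤ (eulerianTournaments n).card :=
    Finset.card_le_card (Finset.filter_subset _ _)
  norm_num at h1 h2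
  calc n ^ 4 * (almostNested n 1 a w).card = n ^ 2 * (n ^ 2 * (almostNested n 1 a w).card) := by
        ring
    _ ≤ n ^ 2 * (16 * (almostNested n 2 a w).card) := Nat.mul_le_mul_left _ h1
    _ = 16 * (n ^ 2 * (almostNested n 2 a w).card) := by ring
    _ ≤ 16 * (36 * (almostNested n 3 a w).card) := Nat.mul_le_mul_left _ h2
    _ ≤ 576 * (eulerianTournaments n).card := by omega

open Classical in
theorem filter_isObliviousDigraph_subset {n : ℕ} (hn : 1 ≤ n) :
    (eulerianTournaments n).filter IsObliviousDigraph ⊆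
      (Finset.univ : Finset (Fin (2 * n + 1))).offDiag.biUnion
        fun p => almostNested n 1 p.1 p.2 := by
  intro D hD
  obtain ⟨hD, hobl⟩ := Finset.mem_filter.1 hD
  obtain ⟨hT, hE⟩ := mem_eulerianTournaments.1 hD
  have : Nontrivial (Fin (2 * n + 1)) := Fin.nontrivial_iff_two_le.2 (by omega)
  -- Any fixed exceptional vertex serves; only the size of the difference matters.
  obtain ⟨a, w, haw, h⟩ := exists_outNbhd_diff_subset hT hE hobl 0
  refine Finset.mem_biUnion.2 ⟨(a, w), by simpa using haw, mem_almostNested.2 ⟨⟨hT, hE⟩, ?_⟩⟩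
  rw [← coe_outFinset, ← coe_outFinset, ← Finset.coe_sdiff, ← Finset.coe_singleton,
    Finset.coe_subset] at h
  exact (Finset.card_le_card h).trans (Finset.card_singleton _).le

open Classical in
theorem sq_mul_card_filter_isObliviousDigraph_le {n : ℕ} (hn : 28 ≤ n) :
    n ^ 2 * ((eulerianTournaments n).filter IsObliviousDigraph).card ≤
      5184 * (eulerianTournaments n).card := by
  set B := (eulerianTournaments n).filter IsObliviousDigraph
  set E := (eulerianTournaments n).card
  have h1 : n ^ 4 * B.card ≤ (2 * n + 1) ^ 2 * (576 * E) := by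
    calc n ^ 4 * B.card ≤ n ^ 4 * ∑ p ∈ (Finset.univ : Finset (Fin (2 * n + 1))).offDiag,
          (almostNested n 1 p.1 p.2).card := Nat.mul_le_mul_left _
            ((Finset.card_le_card (filter_isObliviousDigraph_subset (by omega))).trans
              Finset.card_biUnion_le)
      _ ≤ ∑ _p ∈ (Finset.univ : Finset (Fin (2 * n + 1))).offDiag, 576 * E := by
          rw [Finset.mul_sum]
          exact Finset.sum_le_sum fun p hp =>
            pow_four_mul_card_almostNested_le hn (Finset.mem_offDiag.1 hp).2.2
      _ ≤ (2 * n + 1) ^ 2 * (576 * E) := by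
          rw [Finset.sum_const, smul_eq_mul, Finset.offDiag_card, Finset.card_univ,
            Fintype.card_fin, sq]
          exact Nat.mul_le_mul_right _ (Nat.sub_le _ _)
  have h2 : (2 * n + 1) ^ 2 ≤ 9 * n ^ 2 := by nlinarith
  have h3 : n ^ 2 * (n ^ 2 * B.card) ≤ n ^ 2 * (5184 * E) := by
    calc n ^ 2 * (n ^ 2 * B.card) = n ^ 4 * B.card := by ring
      _ ≤ (2 * n + 1) ^ 2 * (576 * E) := h1
      _ ≤ 9 * n ^ 2 * (576 * E) := Nat.mul_le_mul_right _ h2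
      _ = n ^ 2 * (5184 * E) := by ring
  exact Nat.le_of_mul_le_mul_left h3 (by positivity)

end Counting

end SemiRestricted

theorem mainTheorem6 :
    ∃ C : ℝ, 0 < C ∧ ∀ n : ℕ, 1 ≤ n →
      ((SemiRestricted.randomEulerianTournament n).toOuterMeasure
        {D | SemiRestricted.IsObliviousDigraph D}).toReal ≤ C * (n : ℝ) ^ (-2 : ℤ) := by
  classical
  -- `5184 = 9 * 576`, from `(2 n + 1)² ≤ 9 n²` pairs and the two switching factors `16 * 36`.
  refine ⟨5184, by norm_num, fun n hn => ?_⟩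
  have hn0 : (0 : ℝ) < n := by exact_mod_cast hn
  have hE : (0 : ℝ) < (SemiRestricted.eulerianTournaments n).card := by
    exact_mod_cast (SemiRestricted.eulerianTournaments_nonempty n).card_pos
  rw [SemiRestricted.randomEulerianTournament, PMF.toOuterMeasure_uniformOfFinset_apply,
    ENNReal.toReal_div, ENNReal.toReal_natCast, ENNReal.toReal_natCast, zpow_neg,
    ← div_eq_mul_inv, div_le_div_iff₀ hE (by positivity), mul_comm]
  simp only [Set.mem_ofPred_eq]
  norm_cast
  rcases le_or_gt 28 n with h | h
  · exact SemiRestricted.sq_mul_card_filter_isObliviousDigraph_le h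
  -- For `n < 28` the bound is trivial because `n² ≤ 5184`.
  · refine Nat.mul_le_mul (by nlinarith) (Finset.card_filter_le _ _)
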